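/- All graphs are finite and simple. For graphs $G$ and $F$ on $n$ vertices, the friends-and-strangers graph $\mathrm{FS}(G,F)$ has as vertices the bijections $\sigma: V(G)\to V(F)$; two bijections $\sigma,\sigma'$ are adjacent if there is an edge $\{A,B\}$ of $G$ such that $\{\sigma(A),\sigma(B)\}$ is an edge of $F$, $\sigma'(A)=\sigma(B)$, $\sigma'(B)=\sigma(A)$, and $\sigma'(C)=\sigma(C)$ for all other vertices $C$. For $0\le k\le n$, the book graph $B^{(k)}_{n-k}$ on $n$ vertices consists of $n-k$ copies of the complete graph $K_{k+1}$ joined along a common $K_k$ (so $B^{(n)}_0=K_n$). A graph is biconnected if it is connected and has no cut-vertex, i.e. no vertex whose removal increases the number of connected components. A cycle has length at least $3$. Stringless Balloon Lemma. Let $2\le k\le n$, and let $G$ be a biconnected graph on $n$ vertices that is not a cycle of length strictly greater than $k+1$. Then $\mathrm{FS}(G,B^{(k)}_{n-k})$ is connected. In particular, for every $n\ge 2$ and every biconnected graph $G$ on $n$ vertices that is not a cycle (bipartite or not), $\mathrm{FS}(G,B^{(2)}_{n-2})$ is connected; and $\mathrm{FS}(\theta_0,B^{(2)}_{5})$ is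 connected, where $\theta_0$ is the graph on $7$ vertices obtained from a $6$-cycle by adding one new vertex joined to two opposite vertices of the cycle. -/

import Mathlib

namespace FriendsStrangers

/-- The friends-and-strangers graph `FS(G, F)`: its vertices are the bijections `V(G) → V(F)`, and
`σ`, `σ'` are adjacent iff `σ'` arises from `σ` by exchanging the people lying at the two endpoints
of some edge `{A, B}` of `G`, where these two people are friends (adjacent in `F`). -/
def FS {V W : Type*} (G : SimpleGraph V) (F : SimpleGraph W) : SimpleGraph (V ≃ W) where
  Adj σ σ' := ∃ A B : V, G.Adj A B ∧ F.Adj (σ A) (σ B) ∧ σ A = σ' B ∧ σ B = σ' A ∧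
    ∀ C : V, C ≠ A → C ≠ B → σ C = σ' C
  symm := ⟨by
    rintro σ σ' ⟨A, B, hG, hF, h1, h2, h3⟩
    refine ⟨A, B, hG, ?_, h2.symm, h1.symm, fun C hA hB => (h3 C hA hB).symm⟩
    rw [← h1, ← h2]
    exact hF.symm⟩
  loopless := ⟨by
    rintro σ ⟨A, B, hG, -, h1, -, -⟩
    exact hG.ne (σ.injective h1)⟩

/-- The book graph `B_m^{(k)}` on `k + m` vertices: `m` copies of the complete graph on `k + 1`
vertices, joined along a common complete graph on `k` vertices. The common vertices are those of
`Fin k`; each `j : Fin m` is the remaining vertex of the `j`-th copy. Thus two distinct vertices are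
adjacent iff at least one of them is a common vertex. -/
def bookGraph (k m : ℕ) : SimpleGraph (Fin k ⊕ Fin m) where
  Adj x y := x ≠ y ∧ (x.isLeft = true ∨ y.isLeft = true)
  symm := ⟨fun _ _ h => ⟨h.1.symm, h.2.symm⟩⟩
  loopless := ⟨fun _ h => h.1 rfl⟩

/-- `v` is a cut-vertex of `G` if removing it increases the number of connected components. -/
def IsCutVertex {V : Type*} (G : SimpleGraph V) (v : V) : Prop :=
  ENat.card G.ConnectedComponent < ENat.card (G.induce ({v}ᶜ : Set V)).ConnectedComponent

/-- A graph is biconnected if it is connected and has no cut-vertex. (A single edge is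
biconnected.) -/
def IsBiconnected {V : Type*} (G : SimpleGraph V) : Prop :=
  G.Connected ∧ ∀ v : V, ¬ IsCutVertex G v

/-- `G` is a cycle of length `l` (where `l ≥ 3`): the whole graph is a copy of `C_l`. -/
def IsCycleOfLength {V : Type*} (G : SimpleGraph V) (l : ℕ) : Prop :=
  3 ≤ l ∧ Nonempty (G ≃g SimpleGraph.cycleGraph l)

/-- The graph `θ₀`: the 6-cycle `0, 1, 2, 3, 4, 5` with a seventh vertex `6` joined to the two
opposite vertices `0` and `3`. -/
def theta0 : SimpleGraph (Fin 7) :=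
  SimpleGraph.fromEdgeSet
    {s(0, 1), s(1, 2), s(2, 3), s(3, 4), s(4, 5), s(5, 0), s(0, 6), s(6, 3)}

end FriendsStrangers

/-! If `n ≤ k + 1`, the book graph is complete, every swap along an edge of `G` is legal, and
connectedness of `G` suffices. Otherwise `G` is not a cycle, so it has a vertex of degree at least
3. Then two common vertices of the book are enough: as hubs, friends with everybody, they move
freely like the blanks of a sliding puzzle (`FS_hub_connected`).

A set is mixing if, with both hubs in it, any two other people in it can be exchanged. A claw is
mixing: its leaves are sidings for reversing two people (`isMixing_claw`). A connected mixing set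
`S` grows by an adjacent vertex `e`: the attaching vertex `u` is no cut-vertex, so a hub can leave
through `e` and re-enter elsewhere, which draws the person at `e` into `S` (`IsMixing.insert`). A
maximal such set is therefore everything, and all transpositions along edges are reachable. -/

namespace FriendsStrangers

open Equiv

/-! ### Reachability in general friends-and-strangers graphs. -/

section General

variable {V W : Type*}

theorem swap_trans_eq_trans_swap [DecidableEq V] [DecidableEq W] (σ : V ≃ W) (A B : V) :
    (swap A B).trans σ = σ.trans (swap (σ A) (σ B)) := by
  ext C
  simp only [trans_apply, swap_apply_def, σ.injective.eq_iff]
  split_ifs <;> rfl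

theorem FS_mono {G : SimpleGraph V} {F F' : SimpleGraph W} (h : F ≤ F') : FS G F ≤ FS G F' := by
  rintro σ τ ⟨A, B, hG, hF, h1⟩
  exact ⟨A, B, hG, h hF, h1⟩

theorem FS_adj_swap [DecidableEq V] {G : SimpleGraph V} {F : SimpleGraph W} {σ : V ≃ W} {A B : V}
    (hG : G.Adj A B) (hF : F.Adj (σ A) (σ B)) : (FS G F).Adj σ ((swap A B).trans σ) :=
  ⟨A, B, hG, hF, by simp, by simp, fun C hA hB => by simp [swap_apply_of_ne_of_ne hA hB]⟩

/-- Relabelling the people by an automorphism of the friendship graph preserves reachability. -/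
theorem FS_reachable_relabel {G : SimpleGraph V} {F : SimpleGraph W} (φ : Perm W)
    (hφ : ∀ a b, F.Adj a b → F.Adj (φ a) (φ b)) {σ τ : V ≃ W} (h : (FS G F).Reachable σ τ) :
    (FS G F).Reachable (σ.trans φ) (τ.trans φ) := by
  let f : FS G F →g FS G F :=
    { toFun := fun ρ => ρ.trans φ
      map_rel' := by
        rintro ρ ρ' ⟨A, B, hG, hF, h1, h2, h3⟩
        exact ⟨A, B, hG, hφ _ _ hF, by simp [h1], by simp [h2],
          fun C hA hB => by simp [h3 C hA hB]⟩ }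
  exact h.map f

/-- If the people at the ends of any edge can be exchanged from any configuration, then every
configuration can be reached. -/
theorem FS_connected_of_swap [DecidableEq V] {G : SimpleGraph V} {F : SimpleGraph W} [Finite V] [Nonempty (V ≃ W)]
    (hG : G.Preconnected)
    (h : ∀ (σ : V ≃ W) (A B : V), G.Adj A B → (FS G F).Reachable σ ((swap A B).trans σ)) :
    (FS G F).Connected := by
  have hswap : ∀ A B : V, ∀ σ : V ≃ W, (FS G F).Reachable σ ((swap A B).trans σ) := by
    intro A B
    have hAB := (SimpleGraph.reachable_iff_reflTransGen A B).1 (hG A B)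
    induction hAB with
    | refl => intro σ; simp
    | @tail B C _ hBC ih =>
      intro σ
      by_cases hAB : A = B
      · subst hAB; exact h σ _ _ hBC
      by_cases hAC : A = C
      · subst hAC; simp
      have key : (swap A C).trans σ
          = (swap A B).trans ((swap B C).trans ((swap A B).trans σ)) := by
        have := swap_mul_swap_mul_swap hBC.ne.symm (Ne.symm hAC)
        rw [← this, swap_comm B A, swap_comm C B]
        rfl
      rw [key]
      exact ((ih σ).trans (h _ _ _ hBC)).trans (ih _)
  have hperm : ∀ φ : Perm V, ∀ σ : V ≃ W, (FS G F).Reachable σ (φ.trans σ) := by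
    intro φ
    induction φ using Perm.swap_induction_on with
    | one => intro σ; exact SimpleGraph.Reachable.refl _
    | swap_mul f A B _ ih =>
      intro σ
      have := (hswap A B σ).trans (ih ((swap A B).trans σ))
      exact this
  refine ⟨fun σ τ => ?_⟩
  have := hperm (τ.trans σ.symm) σ
  rwa [Equiv.trans_assoc, Equiv.symm_trans_self, Equiv.trans_refl] at this

end General

/-- The friendship graph in which `x` and `y` are friends with everybody and there are no other
friendships. -/
def hubGraph {W : Type*} (x y : W) : SimpleGraph W where
  Adj a b := a ≠ b ∧ ((a = x ∨ a = y) ∨ (b = x ∨ b = y))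
  symm := ⟨fun _ _ h => ⟨h.1.symm, h.2.symm⟩⟩
  loopless := ⟨fun _ h => h.1 rfl⟩

/-- A set of unordered pairs of distinct vertices of a connected graph that is nonempty and closed
under moving one member of a pair along an edge contains all pairs. -/
theorem pair_mem_of_closed {U : Type*} {H : SimpleGraph U} (hH : H.Preconnected)
    (X : U → U → Prop) (hsymm : ∀ a b, X a b → X b a)
    (hmove : ∀ a b c, X a b → a ≠ b → H.Adj b c → c ≠ a → X a c)
    {a b c d : U} (hab : X a b) (hne : a ≠ b) (hcd : c ≠ d) : X c d := by
  have key : ∀ a b, X a b → a ≠ b → ∀ c, c ≠ a → X a c := by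
    intro a b hab hne c
    -- The walk may run through `a`. The second clause then keeps a neighbour `d` of `a` with `X a
    -- d`: the token at `a` moves ahead to the next vertex, and the one at `d` steps into `a`.
    suffices hs : (c ≠ a → X a c) ∧ (c = a → ∃ d, H.Adj a d ∧ X a d) from hs.1
    have hr := (SimpleGraph.reachable_iff_reflTransGen b c).1 (hH b c)
    induction hr with
    | refl => exact ⟨fun _ => hab, fun h => absurd h.symm hne⟩
    | @tail c c' _ hcc' ih =>
      refine ⟨fun hc' => ?_, fun hc' => ?_⟩
      · by_cases hc : c = a
        · subst hc
          obtain ⟨d, had, hX⟩ := ih.2 rfl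
          by_cases hd : c' = d
          · exact hd ▸ hX
          · exact hsymm _ _ (hmove c' d c
              (hsymm _ _ (hmove d c c' (hsymm _ _ hX) had.ne.symm hcc' hd)) hd had.symm hc'.symm)
        · exact hmove _ _ _ (ih.1 hc) (Ne.symm hc) hcc' hc'
      · subst hc'
        exact ⟨c, hcc'.symm, ih.1 hcc'.ne⟩
  by_cases hca : c = a
  · subst hca; exact key c b hab hne d hcd.symm
  · exact key c a (hsymm _ _ (key a b hab hne c hca)) hca d hcd.symm

/-! ### Moving the two hubs. -/

section Hub

variable {V W : Type*} {G : SimpleGraph V} {x y : W}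

theorem hub_reachable_swap [DecidableEq V] {σ : V ≃ W} {A B : V} (hG : G.Adj A B) (hA : σ A = x ∨ σ A = y) :
    (FS G (hubGraph x y)).Reachable σ ((swap A B).trans σ) :=
  (FS_adj_swap (F := hubGraph x y) hG
    ⟨fun h => hG.ne (σ.injective h), Or.inl hA⟩).reachable

theorem hub_reachable_relabel (φ : Perm W) (hx : φ x = x ∨ φ x = y) (hy : φ y = x ∨ φ y = y)
    {σ τ : V ≃ W} (h : (FS G (hubGraph x y)).Reachable σ τ) :
    (FS G (hubGraph x y)).Reachable (σ.trans φ) (τ.trans φ) := by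
  refine FS_reachable_relabel φ ?_ h
  rintro a b ⟨hab, h⟩
  refine ⟨fun h' => hab (φ.injective h'), ?_⟩
  rcases h with (rfl | rfl) | (rfl | rfl) <;> tauto

/-- One hub walks towards the other, they swap on meeting, and the walk is undone with the names of
the hubs interchanged. -/
theorem hub_reachable_swap_hubs [DecidableEq V] [DecidableEq W] (hG : G.Preconnected) (hxy : x ≠ y) (σ : V ≃ W) :
    (FS G (hubGraph x y)).Reachable σ (σ.trans (swap x y)) := by
  have key : ∀ A B : V, ∀ p : G.Walk A B, ∀ σ : V ≃ W, σ A = x → σ B = y →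
      (FS G (hubGraph x y)).Reachable σ (σ.trans (swap x y)) := by
    intro A B p
    induction p with
    | nil => intro σ h1 h2; exact absurd (h1.symm.trans h2) hxy
    | @cons A C B hAC p ih =>
      intro σ hA hB
      have h1 := hub_reachable_swap (y := y) hAC (Or.inl hA)
      by_cases hCB : C = B
      · subst hCB
        rwa [swap_trans_eq_trans_swap, hA, hB] at h1
      have hBA : B ≠ A := fun h => hxy (by rw [← hA, ← hB, h])
      have h2 := ih ((swap A C).trans σ) (by simpa using hA)
        (by simpa [swap_apply_of_ne_of_ne hBA (Ne.symm hCB)] using hB)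
      exact (h1.trans h2).trans
        (hub_reachable_relabel (swap x y) (by simp) (by simp) h1).symm
  exact key (σ.symm x) (σ.symm y) (hG _ _).some σ (by simp) (by simp)

theorem hub_reachable_swap_of_hubs [DecidableEq V] [DecidableEq W] (hG : G.Preconnected) (hxy : x ≠ y) {σ : V ≃ W} {A B : V}
    (hA : σ A = x ∨ σ A = y) (hB : σ B = x ∨ σ B = y) :
    (FS G (hubGraph x y)).Reachable σ ((swap A B).trans σ) := by
  have h := hub_reachable_swap_hubs hG hxy σ
  rw [swap_trans_eq_trans_swap]
  rcases hA with hA | hA <;> rcases hB with hB | hB <;> rw [hA, hB]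
  · simp
  · exact h
  · rwa [swap_comm]
  · simp

/-- A hub standing in `T` can walk within the induced subgraph on `T`, leaving the rest of the graph
untouched. -/
theorem exists_reachable_walk [DecidableEq V] {T : Set V} {e f : T} (hef : (G.induce T).Reachable e f)
    (σ : V ≃ W) (he : σ e = x ∨ σ e = y) :
    ∃ τ : V ≃ W, (FS G (hubGraph x y)).Reachable σ τ ∧ τ f = σ e ∧ ∀ C, C ∉ T → τ C = σ C := by
  rw [SimpleGraph.reachable_iff_reflTransGen] at hef
  induction hef with
  | refl => exact ⟨σ, .refl _, rfl, fun _ _ => rfl⟩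
  | @tail f f' _ hff' ih =>
    obtain ⟨τ, h1, h2, h3⟩ := ih
    refine ⟨(swap (f : V) f').trans τ, h1.trans (hub_reachable_swap hff' (h2 ▸ he)), by simpa,
      fun C hC => ?_⟩
    rw [trans_apply, swap_apply_of_ne_of_ne (ne_of_mem_of_not_mem f.2 hC).symm
      (ne_of_mem_of_not_mem f'.2 hC).symm, h3 C hC]

/-- Two hubs standing in a connected set `S` can be brought to any two places of `S`, leaving the
rest of the graph untouched. -/
theorem exists_reachable_hubs_at [DecidableEq V] {S : Set V} (hS : (G.induce S).Preconnected)
    {a b c d : V} (ha : a ∈ S) (hb : b ∈ S) (hc : c ∈ S) (hd : d ∈ S) (hab : a ≠ b) (hcd : c ≠ d)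
    (σ : V ≃ W) (hσa : σ a = x ∨ σ a = y) (hσb : σ b = x ∨ σ b = y) :
    ∃ τ : V ≃ W, (FS G (hubGraph x y)).Reachable σ τ ∧ (∀ C, C ∉ S → τ C = σ C) ∧
      (τ c = x ∨ τ c = y) ∧ (τ d = x ∨ τ d = y) := by
  refine pair_mem_of_closed hS (fun c d => ∃ τ : V ≃ W, (FS G (hubGraph x y)).Reachable σ τ ∧
    (∀ C, C ∉ S → τ C = σ C) ∧ (τ c = x ∨ τ c = y) ∧ (τ d = x ∨ τ d = y)) ?_ ?_
    (a := ⟨a, ha⟩) (b := ⟨b, hb⟩) (c := ⟨c, hc⟩) (d := ⟨d, hd⟩)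
    ⟨σ, .refl _, fun _ _ => rfl, hσa, hσb⟩ (by simpa using hab) (by simpa using hcd)
  · rintro a b ⟨τ, h1, h2, h3, h4⟩
    exact ⟨τ, h1, h2, h4, h3⟩
  · rintro a b c ⟨τ, h1, h2, h3, h4⟩ hab hbc hca
    refine ⟨(swap (b : V) c).trans τ, h1.trans (hub_reachable_swap hbc h4), fun C hC => ?_, ?_, ?_⟩
    · rw [trans_apply, swap_apply_of_ne_of_ne (ne_of_mem_of_not_mem b.2 hC).symm
      (ne_of_mem_of_not_mem c.2 hC).symm, h2 C hC]
    · rwa [trans_apply, swap_apply_of_ne_of_ne (fun h => hab (Subtype.ext h))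
        (fun h => hca (Subtype.ext h.symm))]
    · simpa using h4

end Hub

/-! ### Exchanging two non-hubs; mixing sets. -/

section Exchange

variable {V W : Type*} {G : SimpleGraph V} {x y : W}

/-- The people `p` and `q`, neither of them a hub, can be exchanged from the configuration `σ`. -/
def Exchangeable [DecidableEq W] (G : SimpleGraph V) (x y : W) (σ : V ≃ W) (p q : W) : Prop :=
  (FS G (hubGraph x y)).Reachable σ (σ.trans (swap p q))

/-- `C` is not occupied by a hub. -/
def IsTile (x y : W) (σ : V ≃ W) (C : V) : Prop := σ C ≠ x ∧ σ C ≠ y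

theorem hub_reachable_relabel_swap [DecidableEq W] {p q : W} (hp : p ≠ x ∧ p ≠ y) (hq : q ≠ x ∧ q ≠ y)
    {σ τ : V ≃ W} (h : (FS G (hubGraph x y)).Reachable σ τ) :
    (FS G (hubGraph x y)).Reachable (σ.trans (swap p q)) (τ.trans (swap p q)) :=
  hub_reachable_relabel _ (Or.inl (swap_apply_of_ne_of_ne hp.1.symm hq.1.symm))
    (Or.inr (swap_apply_of_ne_of_ne hp.2.symm hq.2.symm)) h

/-- Conjugation: go to `τ`, exchange, and retrace the moves with `p` and `q` interchanged, which is
legal because this relabelling fixes both hubs. -/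
theorem Exchangeable.of_reachable [DecidableEq W] {p q : W} (hp : p ≠ x ∧ p ≠ y) (hq : q ≠ x ∧ q ≠ y)
    {σ τ : V ≃ W} (hr : (FS G (hubGraph x y)).Reachable σ τ) (h : Exchangeable G x y τ p q) :
    Exchangeable G x y σ p q :=
  (hr.trans h).trans (hub_reachable_relabel_swap hp hq hr).symm

theorem Exchangeable.refl [DecidableEq W] (σ : V ≃ W) (p : W) : Exchangeable G x y σ p p := by
  unfold Exchangeable
  simp

theorem Exchangeable.symm [DecidableEq W] {σ : V ≃ W} {p q : W} (h : Exchangeable G x y σ p q) :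
    Exchangeable G x y σ q p := by
  unfold Exchangeable at *
  rwa [swap_comm]

theorem Exchangeable.trans [DecidableEq W] {σ : V ≃ W} {p q r : W} (hp : p ≠ x ∧ p ≠ y) (hq : q ≠ x ∧ q ≠ y)
    (hr : r ≠ x ∧ r ≠ y) (h1 : Exchangeable G x y σ p q) (h2 : Exchangeable G x y σ q r) :
    Exchangeable G x y σ p r := by
  by_cases hqr : q = r
  · exact hqr ▸ h1
  by_cases hpr : p = r
  · exact hpr ▸ Exchangeable.refl σ p
  have key : σ.trans (swap p r) = ((σ.trans (swap p q)).trans (swap q r)).trans (swap p q) := by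
    have := swap_mul_swap_mul_swap (Ne.symm hqr) (Ne.symm hpr)
    rw [swap_comm q p, swap_comm r q] at this
    rw [← this]
    rfl
  unfold Exchangeable at *
  rw [key]
  have h3 := hub_reachable_relabel_swap hp hq (hub_reachable_relabel_swap hq hr h1)
  have h4 := hub_reachable_relabel_swap hp hq h2
  exact (h1.trans h4).trans h3

/-- Whenever both hubs stand in `S`, any two of the other people standing in `S` can be
exchanged. -/
def IsMixing [DecidableEq W] (G : SimpleGraph V) (x y : W) (S : Set V) : Prop :=
  ∀ σ : V ≃ W, ∀ a ∈ S, ∀ b ∈ S, a ≠ b → ¬ IsTile x y σ a → ¬ IsTile x y σ b →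
    ∀ C ∈ S, ∀ D ∈ S, IsTile x y σ C → IsTile x y σ D → Exchangeable G x y σ (σ C) (σ D)

theorem not_isTile {σ : V ≃ W} {C : V} : ¬ IsTile x y σ C ↔ σ C = x ∨ σ C = y := by
  unfold IsTile
  tauto

/-- At most two places are occupied by hubs. -/
theorem isTile_of_ne {σ : V ≃ W} {a b C : V} (hab : a ≠ b) (ha : ¬ IsTile x y σ a)
    (hb : ¬ IsTile x y σ b) (hCa : C ≠ a) (hCb : C ≠ b) : IsTile x y σ C := by
  have h1 := σ.injective.ne hab
  have h2 := σ.injective.ne hCa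
  have h3 := σ.injective.ne hCb
  rw [not_isTile] at ha hb
  by_contra hC
  rw [not_isTile] at hC
  grind

/-- To see that a connected set is mixing it suffices to look at configurations with the hubs in
two fixed places. -/
theorem isMixing_of_hubs_at [DecidableEq V] [DecidableEq W] {S : Set V} (hS : (G.induce S).Preconnected) {c d : V} (hc : c ∈ S)
    (hd : d ∈ S) (hcd : c ≠ d)
    (h : ∀ τ : V ≃ W, ¬ IsTile x y τ c → ¬ IsTile x y τ d → ∃ s, s ≠ c ∧ s ≠ d ∧
      ∀ C ∈ S, C ≠ c → C ≠ d → Exchangeable G x y τ (τ C) (τ s)) :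
    IsMixing G x y S := by
  intro σ a ha b hb hab hσa hσb C hC D hD hσC hσD
  obtain ⟨τ, hr, hout, hτc, hτd⟩ :=
    exists_reachable_hubs_at hS ha hb hc hd hab hcd σ (not_isTile.1 hσa) (not_isTile.1 hσb)
  rw [← not_isTile] at hτc hτd
  obtain ⟨s, hsc, hsd, hs⟩ := h τ hτc hτd
  have hst : IsTile x y τ s := isTile_of_ne hcd hτc hτd hsc hsd
  have key : ∀ C ∈ S, IsTile x y σ C → Exchangeable G x y τ (σ C) (τ s) := by
    intro C hC hσC
    obtain ⟨C', hC'⟩ := τ.surjective (σ C)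
    -- Nothing outside `S` has changed, so the people of `S` are still in `S`.
    have hC'S : C' ∈ S := by
      by_contra hn
      rw [hout C' hn] at hC'
      exact hn (σ.injective hC' ▸ hC)
    have hC't : IsTile x y τ C' := by
      unfold IsTile
      rwa [hC']
    rw [← hC']
    exact hs C' hC'S (fun h => hτc (h ▸ hC't)) (fun h => hτd (h ▸ hC't))
  exact Exchangeable.of_reachable hσC hσD hr
    (Exchangeable.trans hσC hst hσD (key C hC hσC) (key D hD hσD).symm)

/-- The three leaves of a claw and its centre form a mixing set. -/
theorem isMixing_claw [DecidableEq V] [DecidableEq W] (hG : G.Preconnected) (hxy : x ≠ y) {v a b c : V} (ha : G.Adj v a)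
    (hb : G.Adj v b) (hc : G.Adj v c) (hab : a ≠ b) (hac : a ≠ c) (hbc : b ≠ c)
    (hS : (G.induce ({v, a, b, c} : Set V)).Preconnected) : IsMixing G x y {v, a, b, c} := by
  refine isMixing_of_hubs_at hS (c := b) (d := c) (by simp) (by simp) hbc fun τ hτb hτc =>
    ⟨v, hb.ne, hc.ne, ?_⟩
  suffices h : Exchangeable G x y τ (τ a) (τ v) by
    rintro C (rfl | rfl | rfl | rfl) h1 h2
    · exact Exchangeable.refl _ _
    · exact h
    · exact absurd rfl h1
    · exact absurd rfl h2
  have hva := ha.ne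
  have hvb := hb.ne
  have hvc := hc.ne
  have hav := hva.symm
  have hbv := hvb.symm
  have hcv := hvc.symm
  have hba := hab.symm
  have hca := hac.symm
  have hcb := hbc.symm
  rw [not_isTile] at hτb hτc
  unfold Exchangeable
  -- The person at `v` is parked at `b` and the one at `a` at `c`; they then return in the other
  -- order, to `a` and `v`. This leaves the hubs interchanged, which `r7` repairs.
  have r1 := hub_reachable_swap (σ := τ) hb.symm hτb
  set τ1 := (swap b v).trans τ with e1
  have r2 := hub_reachable_swap (x := x) (y := y) (σ := τ1) ha
    (by simp [*])
  set τ2 := (swap v a).trans τ1 with e2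
  have r3 := hub_reachable_swap (x := x) (y := y) (σ := τ2) hc.symm
    (by simp [swap_apply_def, *])
  set τ3 := (swap c v).trans τ2 with e3
  have r4 := hub_reachable_swap (x := x) (y := y) (σ := τ3) hb
    (by simp [swap_apply_def, *])
  set τ4 := (swap v b).trans τ3 with e4
  have r5 := hub_reachable_swap (x := x) (y := y) (σ := τ4) ha.symm (by
    simp [swap_apply_def, *])
  set τ5 := (swap a v).trans τ4 with e5
  have r6 := hub_reachable_swap (x := x) (y := y) (σ := τ5) hc (by
    simp [swap_apply_def, *])
  set τ6 := (swap v c).trans τ5 with e6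
  have r7 := hub_reachable_swap_of_hubs hG hxy (σ := τ6) (A := b) (B := c) (by
    simp [swap_apply_def, *]) (by
    simp [swap_apply_def, *])
  have e7 : (swap b c).trans τ6 = τ.trans (swap (τ a) (τ v)) := by
    rw [← swap_trans_eq_trans_swap]
    ext C
    simp only [e1, e2, e3, e4, e5, e6, trans_apply]
    congr 1
    simp only [swap_apply_def]
    grind
  rw [← e7]
  exact r1.trans <| r2.trans <| r3.trans <| r4.trans <| r5.trans <| r6.trans r7

/-- If `u` is not a cut-vertex, an outside neighbour `e` of `S` is joined, avoiding `S`, to a vertex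
adjacent to a vertex of `S` other than `u`. -/
theorem exists_exit {S : Set V} {u e s : V} (hu : (G.induce ({u}ᶜ : Set V)).Preconnected)
    (huS : u ∈ S) (he : e ∉ S) (hs : s ∈ S) (hsu : s ≠ u) :
    ∃ w ∈ S, w ≠ u ∧ ∃ f : (Sᶜ : Set V), G.Adj f w ∧
      (G.induce (Sᶜ : Set V)).Reachable ⟨e, he⟩ f := by
  have hr := (SimpleGraph.reachable_iff_reflTransGen _ _).1
    (hu ⟨e, fun h => he (h ▸ huS)⟩ ⟨s, hsu⟩)
  -- Along a path from `e` to `s` avoiding `u`, either `S` has been entered or the part travelled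
  -- lies outside `S`.
  suffices h : ∀ t : ({u}ᶜ : Set V),
      Relation.ReflTransGen (G.induce ({u}ᶜ : Set V)).Adj ⟨e, fun h => he (h ▸ huS)⟩ t →
      (∃ w ∈ S, w ≠ u ∧ ∃ f : (Sᶜ : Set V), G.Adj f w ∧
        (G.induce (Sᶜ : Set V)).Reachable ⟨e, he⟩ f) ∨
      ∃ ht : (t : V) ∉ S, (G.induce (Sᶜ : Set V)).Reachable ⟨e, he⟩ ⟨t, ht⟩ by
    rcases h _ hr with h | ⟨ht, -⟩
    · exact h
    · exact absurd hs ht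
  intro t ht
  induction ht with
  | refl => exact Or.inr ⟨he, .refl _⟩
  | @tail t t' _ htt' ih =>
    rcases ih with h | ⟨ht, hr⟩
    · exact Or.inl h
    · by_cases ht' : (t' : V) ∈ S
      · exact Or.inl ⟨t', ht', t'.2, ⟨t, ht⟩, htt', hr⟩
      · exact Or.inr ⟨ht', hr.trans (SimpleGraph.Adj.reachable (by exact htt'))⟩

theorem preconnected_induce_insert {S : Set V} (hS : (G.induce S).Preconnected) {u e : V}
    (hu : u ∈ S) (hue : G.Adj u e) : (G.induce (insert e S)).Preconnected := by
  have hroot : ∀ z : (insert e S : Set V),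
      (G.induce (insert e S)).Reachable ⟨u, Set.mem_insert_of_mem _ hu⟩ z := by
    rintro ⟨z, hz⟩
    rcases hz with rfl | hz'
    · exact SimpleGraph.Adj.reachable (by exact hue)
    · exact (hS ⟨u, hu⟩ ⟨z, hz'⟩).map
        (SimpleGraph.induceHomOfLE G (Set.subset_insert e S)).toHom
  exact fun z z' => (hroot z).symm.trans (hroot z')

/-- A connected mixing set with at least four vertices stays mixing when a vertex adjacent to it is
added. -/
theorem IsMixing.insert [DecidableEq V] [DecidableEq W] {S : Set V} (hmix : IsMixing G x y S) (hS : (G.induce S).Preconnected)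
    (h4 : ∀ a b c : V, ∃ s ∈ S, s ≠ a ∧ s ≠ b ∧ s ≠ c) {u e : V}
    (hcut : (G.induce ({u}ᶜ : Set V)).Preconnected) (hu : u ∈ S) (he : e ∉ S) (hue : G.Adj u e) :
    IsMixing G x y (insert e S) := by
  obtain ⟨s₀, hs₀, hs₀u, -, -⟩ := h4 u u u
  obtain ⟨w, hw, hwu, ⟨f, hf⟩, hfw, hef⟩ := exists_exit hcut hu he hs₀ hs₀u
  -- Four distinct places of `S`: exit `u`, entrance `w`, `z` for the idle hub, and `s` for an
  -- undisturbed person.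
  obtain ⟨z, hz, hzu, hzw, -⟩ := h4 u w w
  obtain ⟨s, hs, hsu, hsw, hsz⟩ := h4 u w z
  have hin : ∀ {C}, C ∈ S → C ≠ e ∧ C ≠ f := fun hC =>
    ⟨ne_of_mem_of_not_mem hC he, ne_of_mem_of_not_mem hC hf⟩
  refine isMixing_of_hubs_at (preconnected_induce_insert hS hu hue)
    (Set.mem_insert_of_mem _ hu) (Set.mem_insert_of_mem _ hz) hzu.symm
    fun τ hτu hτz => ⟨s, hsu, hsz, ?_⟩
  have htile : ∀ {C}, C ≠ u → C ≠ z → IsTile x y τ C := isTile_of_ne hzu.symm hτu hτz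
  rintro C (rfl | hC) hCu hCz
  swap
  · exact hmix τ u hu z hz hzu.symm hτu hτz C hC s hs (htile hCu hCz) (htile hsu hsz)
  -- The hub at `u` circles through the new vertex, outside `S` to `f`, and back in at `w`. The
  -- newcomer now stands at `u`, while `z` and `s` are untouched, so mixing of `S` applies.
  have r1 := hub_reachable_swap hue (not_isTile.1 hτu)
  set τ1 := (swap u C).trans τ with e1
  have hCe : τ1 C = τ u := by simp [e1]
  obtain ⟨τ2, r2, h2f, h2⟩ := exists_reachable_walk (x := x) (y := y) hef τ1
    (by rw [hCe]; exact not_isTile.1 hτu)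
  have r3 := hub_reachable_swap (x := x) (y := y) (σ := τ2) hfw
    (by rw [h2f, hCe]; exact not_isTile.1 hτu)
  set τ3 := (swap f w).trans τ2 with e3
  have h3w : τ3 w = τ u := by simp [e3, h2f, hCe]
  have h3 : ∀ D ∈ S, D ≠ w → D ≠ u → τ3 D = τ D := by
    intro D hD hDw hDu
    simp only [e3, trans_apply, swap_apply_of_ne_of_ne (hin hD).2 hDw]
    rw [h2 D (by simpa using hD)]
    simp [swap_apply_def, *]
  have h3u : τ3 u = τ C := by
    simp only [e3, trans_apply, swap_apply_of_ne_of_ne (hin hu).2 hwu.symm]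
    rw [h2 u (by simpa using hu)]
    simp [e1]
  have hr := r1.trans (r2.trans r3)
  have hCt := htile hCu hCz
  have hst := htile hsu hsz
  refine Exchangeable.of_reachable hCt hst hr ?_
  have := hmix τ3 w hw z hz hzw.symm (by unfold IsTile; rwa [h3w])
    (by unfold IsTile; rwa [h3 z hz hzw hzu]) u hu s hs (by unfold IsTile; rwa [h3u])
    (by unfold IsTile; rwa [h3 s hs hsw hsu])
  rwa [h3u, h3 s hs hsw hsu] at this

theorem exists_mem_ne_of_four {v a b c : V} (hva : v ≠ a) (hvb : v ≠ b) (hvc : v ≠ c)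
    (hab : a ≠ b) (hac : a ≠ c) (hbc : b ≠ c) (p q r : V) :
    ∃ s ∈ ({v, a, b, c} : Set V), s ≠ p ∧ s ≠ q ∧ s ≠ r := by
  classical
  have h4 : ({v, a, b, c} : Finset V).card = 4 := by simp [*]
  have h3 : ({p, q, r} : Finset V).card ≤ 3 := Finset.card_le_three
  obtain ⟨s, hs, hn⟩ := Finset.exists_mem_notMem_of_card_lt_card (h3.trans_lt (by omega) :
    ({p, q, r} : Finset V).card < ({v, a, b, c} : Finset V).card)
  simp only [Finset.mem_insert, Finset.mem_singleton, not_or] at hs hn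
  exact ⟨s, hs, hn⟩

/-- Two hubs suffice on every graph without cut-vertices that has a vertex of degree at least
three. -/
theorem FS_hub_connected [DecidableEq V] [DecidableEq W] [Finite V] [Nonempty (V ≃ W)] (hG : G.Preconnected)
    (hcut : ∀ u, (G.induce ({u}ᶜ : Set V)).Preconnected) (hxy : x ≠ y) {v a b c : V}
    (ha : G.Adj v a) (hb : G.Adj v b) (hc : G.Adj v c) (hab : a ≠ b) (hac : a ≠ c) (hbc : b ≠ c) :
    (FS G (hubGraph x y)).Connected := by
  let P : Set V → Prop := fun S => (G.induce S).Preconnected ∧ IsMixing G x y S ∧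
    ∀ a b c : V, ∃ s ∈ S, s ≠ a ∧ s ≠ b ∧ s ≠ c
  have hclaw : P {v, a, b, c} := by
    have hS : (G.induce ({v, a, b, c} : Set V)).Preconnected := by
      have hroot : ∀ z : ({v, a, b, c} : Set V),
          (G.induce ({v, a, b, c} : Set V)).Reachable ⟨v, by simp⟩ z := by
        rintro ⟨z, rfl | rfl | rfl | rfl⟩
        · exact .refl _
        all_goals exact SimpleGraph.Adj.reachable (by assumption)
      exact fun z z' => (hroot z).symm.trans (hroot z')
    refine ⟨hS, isMixing_claw hG hxy ha hb hc hab hac hbc hS, fun p q r => ?_⟩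
    exact exists_mem_ne_of_four ha.ne hb.ne hc.ne hab hac hbc p q r
  -- If a maximal `S` missed a vertex, an edge leaving `S` would allow it to be enlarged.
  obtain ⟨S, hcS, hS⟩ := (Set.toFinite {S | P S}).exists_le_maximal hclaw
  have hmem : ∀ z, z ∈ S := by
    by_contra! hz
    obtain ⟨z, hz⟩ := hz
    obtain ⟨d, -, hd1, hd2⟩ := (hG v z).some.exists_boundary_dart S (hcS (by simp)) hz
    have hPS : P S := hS.1
    have hP : P (insert d.snd S) :=
      ⟨preconnected_induce_insert hPS.1 hd1 d.adj,
        hPS.2.1.insert hPS.1 hPS.2.2 (hcut _) hd1 hd2 d.adj,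
        fun a b c => (hPS.2.2 a b c).imp fun s hs => ⟨Set.mem_insert_of_mem _ hs.1, hs.2⟩⟩
    exact hd2 (hS.2 hP (Set.subset_insert _ _) (Set.mem_insert _ _))
  have hmix : IsMixing G x y S := hS.1.2.1
  refine FS_connected_of_swap hG fun σ A B hAB => ?_
  by_cases hA : IsTile x y σ A
  · by_cases hB : IsTile x y σ B
    · rw [swap_trans_eq_trans_swap]
      exact hmix σ (σ.symm x) (hmem _) (σ.symm y) (hmem _) (σ.symm.injective.ne hxy)
        (by simp [IsTile]) (by simp [IsTile]) A (hmem _) B (hmem _) hA hB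
    · rw [swap_comm]
      exact hub_reachable_swap hAB.symm (not_isTile.1 hB)
  · exact hub_reachable_swap hAB (not_isTile.1 hA)

end Exchange

/-! ### Biconnected graphs and cycles. -/

section Biconnected

variable {V : Type*} {G : SimpleGraph V}

/-- Only `Preconnected`, since a one-vertex graph leaves nothing. -/
theorem IsBiconnected.preconnected_compl (h : IsBiconnected G) (u : V) :
    (G.induce ({u}ᶜ : Set V)).Preconnected := by
  have h1 := h.2 u
  unfold IsCutVertex at h1
  have := h.1.preconnected.subsingleton_connectedComponent
  have h2 : ENat.card (G.induce ({u}ᶜ : Set V)).ConnectedComponent ≤ 1 :=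
    (not_lt.1 h1).trans (ENat.card_le_one_iff_subsingleton _ |>.2 this)
  have := ENat.card_le_one_iff_subsingleton _ |>.1 h2
  intro a b
  exact SimpleGraph.ConnectedComponent.exact (Subsingleton.elim _ _)

theorem isBiconnected_of_preconnected_compl (hG : G.Connected)
    (h : ∀ u, (G.induce ({u}ᶜ : Set V)).Preconnected) : IsBiconnected G := by
  refine ⟨hG, fun u => not_lt.2 ?_⟩
  have := (h u).subsingleton_connectedComponent
  have hne : Nonempty G.ConnectedComponent := hG.nonempty.map G.connectedComponentMk
  exact (ENat.card_le_one_iff_subsingleton _ |>.2 this).trans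
    (ENat.one_le_card_iff_nonempty _ |>.2 hne)

/-- In a biconnected graph on at least three vertices every vertex has a second neighbour. -/
theorem IsBiconnected.exists_other_adj (h : IsBiconnected G) {v w z : V} (hvw : G.Adj v w)
    (hzv : z ≠ v) (hzw : z ≠ w) : ∃ w', w' ≠ w ∧ G.Adj v w' := by
  have hr := (h.preconnected_compl w) ⟨v, hvw.ne⟩ ⟨z, hzw⟩
  obtain ⟨p⟩ := hr
  cases p with
  | nil => exact absurd rfl hzv
  | @cons _ t _ ht _ => exact ⟨t, t.2, ht⟩

theorem ncard_cycleGraph_neighborSet {n : ℕ} (hn : 3 ≤ n) (i : Fin n) :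
    ((SimpleGraph.cycleGraph n).neighborSet i).ncard = 2 := by
  obtain ⟨m, rfl⟩ := Nat.exists_eq_add_of_le' hn
  rw [Set.ncard_eq_toFinset_card', Set.toFinset_card, SimpleGraph.card_neighborSet_eq_degree,
    SimpleGraph.cycleGraph_degree_three_le]

/-- A biconnected graph on at least three vertices without vertices of degree at least three is a
cycle. -/
theorem IsBiconnected.isCycleOfLength [Fintype V] (h : IsBiconnected G) (h3 : 3 ≤ Fintype.card V)
    (hdeg : ∀ v a b c, G.Adj v a → G.Adj v b → G.Adj v c → a = b ∨ a = c ∨ b = c) :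
    IsCycleOfLength G (Fintype.card V) := by
  classical
  have hne : Nontrivial V := Fintype.one_lt_card_iff_nontrivial.1 (by omega)
  have htwo : ∀ v, ∃ a b, a ≠ b ∧ G.neighborSet v = {a, b} := by
    intro v
    obtain ⟨a, ha⟩ := h.1.preconnected.exists_adj_of_nontrivial v
    obtain ⟨z, hz⟩ : ∃ z, z ∉ ({v, a} : Finset V) := by
      by_contra! hz
      have := Finset.card_le_card (fun z _ => hz z : Finset.univ ⊆ ({v, a} : Finset V))
      have := Finset.card_le_two (a := v) (b := a)
      rw [Finset.card_univ] at *
      omega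
    simp only [Finset.mem_insert, Finset.mem_singleton, not_or] at hz
    obtain ⟨b, hba, hb⟩ := h.exists_other_adj ha hz.1 hz.2
    refine ⟨a, b, hba.symm, ?_⟩
    ext c
    simp only [SimpleGraph.mem_neighborSet, Set.mem_insert_iff, Set.mem_singleton_iff]
    refine ⟨fun hc => ?_, ?_⟩
    · rcases hdeg v a b c ha hb hc with h | h | h
      · exact absurd h.symm hba
      · exact Or.inl h.symm
      · exact Or.inr h.symm
    · rintro (rfl | rfl) <;> assumption
  have hcard : ∀ v, (G.neighborSet v).ncard = 2 := by
    intro v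
    obtain ⟨a, b, hab, hv⟩ := htwo v
    rw [hv, Set.ncard_pair hab]
  have hcyc : G.IsCycles := fun v _ => hcard v
  obtain ⟨v⟩ := h.1.nonempty
  obtain ⟨p, hp, hsupp⟩ := hcyc.exists_cycle_toSubgraph_verts_eq_connectedComponentSupp
    (v := v) (c := G.connectedComponentMk v) rfl
    (Set.nonempty_of_ncard_ne_zero (by rw [hcard]; norm_num))
  have hall : ∀ w, w ∈ p.support := by
    intro w
    rw [← SimpleGraph.Walk.mem_verts_toSubgraph, hsupp]
    exact SimpleGraph.ConnectedComponent.sound (h.1.preconnected w v)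
  have hlen : p.length = Fintype.card V := by
    refine (SimpleGraph.Walk.isHamiltonianCycle_iff_isCycle_and_support_count_tail_eq_one.2
      ⟨hp, fun w => List.count_eq_one_of_mem hp.support_nodup ?_⟩).length_eq
    rcases (SimpleGraph.Walk.mem_support_iff p).1 (hall w) with rfl | hw
    · exact SimpleGraph.Walk.end_mem_tail_support hp.not_nil
    · exact hw
  obtain ⟨f⟩ := (SimpleGraph.cycleGraph_isContained_iff (G := G) h3).2 ⟨v, p, hp, hlen⟩
  have hbij : Function.Bijective f :=
    (Fintype.bijective_iff_injective_and_card f).2 ⟨f.injective, by simp⟩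
  refine ⟨h3, ⟨SimpleGraph.Iso.symm ⟨Equiv.ofBijective f hbij, ?_⟩⟩⟩
  intro i j
  refine ⟨fun hij => ?_, fun hij => f.toHom.map_adj hij⟩
  -- Both graphs are 2-regular, so the injective homomorphism `f` is onto on neighbourhoods and
  -- reflects adjacency.
  have hnb : f '' (SimpleGraph.cycleGraph _).neighborSet i = G.neighborSet (f i) := by
    refine Set.eq_of_subset_of_ncard_le ?_ ?_ (Set.toFinite _)
    · rintro _ ⟨k, hk, rfl⟩
      exact f.toHom.map_adj hk
    · rw [hcard, show ⇑f = ⇑f.toHom from rfl, Set.ncard_image_of_injective _ f.injective]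
      exact (ncard_cycleGraph_neighborSet h3 i).ge
  obtain ⟨k, hk, hkj⟩ : f j ∈ f '' (SimpleGraph.cycleGraph _).neighborSet i := hnb ▸ hij
  exact f.injective hkj ▸ hk

end Biconnected

/-! ### Book graphs and `theta0`. -/

section Book

theorem bookGraph_adj_of_le_one {k m : ℕ} (hm : m ≤ 1) {p q : Fin k ⊕ Fin m} (hpq : p ≠ q) :
    (bookGraph k m).Adj p q := by
  refine ⟨hpq, ?_⟩
  rcases p with p | p <;> rcases q with q | q <;> simp
  exact hpq (congrArg Sum.inr (Fin.ext (by omega)))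

/-- The first two common vertices of a book graph are hubs. -/
theorem hubGraph_le_bookGraph {k m : ℕ} (hk : 2 ≤ k) :
    hubGraph (Sum.inl ⟨0, by omega⟩) (Sum.inl ⟨1, by omega⟩) ≤ bookGraph k m := by
  rintro p q ⟨hpq, h⟩
  refine ⟨hpq, ?_⟩
  rcases h with (rfl | rfl) | (rfl | rfl) <;> simp

theorem FS_bookGraph_connected {V : Type*} [Fintype V] {G : SimpleGraph V} {n k : ℕ}
    (hn : Fintype.card V = n) (hG : IsBiconnected G) (hk : 2 ≤ k) (hkn : k ≤ n)
    (hcyc : ¬ ∃ l : ℕ, k + 1 < l ∧ IsCycleOfLength G l) :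
    (FS G (bookGraph k (n - k))).Connected := by
  classical
  have hequiv : Nonempty (V ≃ Fin k ⊕ Fin (n - k)) :=
    ⟨Fintype.equivOfCardEq (by simp; omega)⟩
  -- At most one page remains here; this case absorbs the permitted cycles.
  by_cases hnk : n ≤ k + 1
  · exact FS_connected_of_swap hG.1.preconnected fun σ A B hAB =>
      (FS_adj_swap hAB (bookGraph_adj_of_le_one (by omega) (σ.injective.ne hAB.ne))).reachable
  · obtain ⟨v, a, b, c, ha, hb, hc, hab, hac, hbc⟩ : ∃ v a b c, G.Adj v a ∧ G.Adj v b ∧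
        G.Adj v c ∧ a ≠ b ∧ a ≠ c ∧ b ≠ c := by
      by_contra! hdeg
      refine hcyc ⟨n, by omega, hn ▸ hG.isCycleOfLength (by omega) fun v a b c ha hb hc => ?_⟩
      have := hdeg v a b c ha hb hc
      tauto
    exact (FS_hub_connected hG.1.preconnected hG.preconnected_compl (by simp) ha hb hc hab hac
      hbc).mono (FS_mono (hubGraph_le_bookGraph hk))

/-- A graph in which every vertex but one has a neighbour of smaller rank is connected. -/
theorem preconnected_of_descent {V : Type*} {G : SimpleGraph V} (r : V) (d : V → ℕ)
    (h : ∀ z, z ≠ r → ∃ b, G.Adj z b ∧ d b < d z) : G.Preconnected := by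
  have key : ∀ n z, d z = n → G.Reachable z r := by
    intro n
    induction n using Nat.strong_induction_on with
    | _ n ih =>
      intro z hz
      by_cases hzr : z = r
      · exact hzr ▸ .refl _
      · obtain ⟨b, hb, hlt⟩ := h z hzr
        exact hb.reachable.trans (ih _ (hz ▸ hlt) b rfl)
  exact fun a b => (key _ a rfl).trans (key _ b rfl).symm

theorem theta0_adj {i j : Fin 7} : theta0.Adj i j ↔
    s(i, j) ∈ ({s(0, 1), s(1, 2), s(2, 3), s(3, 4), s(4, 5), s(5, 0), s(0, 6), s(6, 3)} :
      Finset (Sym2 (Fin 7))) := by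
  unfold theta0
  rw [SimpleGraph.fromEdgeSet_adj]
  simp only [Finset.mem_insert, Finset.mem_singleton, Set.mem_insert_iff, Set.mem_singleton_iff]
  refine ⟨fun h => h.1, fun h => ⟨h, ?_⟩⟩
  rintro rfl
  revert h
  revert i
  decide

instance : DecidableRel theta0.Adj := fun _ _ => decidable_of_iff _ theta0_adj.symm

theorem theta0_isBiconnected : IsBiconnected theta0 := by
  -- `d u z` is the distance from `z` to the root `r u` in `theta0` minus `u`; the entries `d u u`
  -- are placeholders, excluded by `b ≠ u`.
  let r : Fin 7 → Fin 7 := ![3, 0, 0, 0, 0, 0, 0]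
  let d : Fin 7 → Fin 7 → ℕ := ![![0, 2, 1, 0, 1, 2, 1], ![0, 0, 3, 2, 2, 1, 1],
    ![0, 1, 0, 2, 2, 1, 1], ![0, 1, 2, 0, 2, 1, 1], ![0, 1, 2, 2, 0, 1, 1], ![0, 1, 2, 2, 3, 0, 1],
    ![0, 1, 2, 3, 2, 1, 0]]
  have hr : ∀ u, r u ≠ u := by decide
  have hd : ∀ u z, z ≠ u → z ≠ r u → ∃ b, b ≠ u ∧ theta0.Adj z b ∧ d u b < d u z := by decide
  refine isBiconnected_of_preconnected_compl ⟨?_⟩ fun u => ?_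
  · exact preconnected_of_descent 0 ![0, 1, 2, 3, 2, 1, 1] (by decide)
  · refine preconnected_of_descent ⟨r u, hr u⟩ (fun z => d u z) fun z hz => ?_
    obtain ⟨b, hb, h⟩ := hd u z z.2 fun h => hz (Subtype.ext h)
    exact ⟨⟨b, hb⟩, h⟩

theorem theta0_not_cycle (l : ℕ) : ¬ IsCycleOfLength theta0 l := by
  rintro ⟨hl, ⟨f⟩⟩
  have h := ncard_cycleGraph_neighborSet hl (f 0)
  have h2 : Fintype.card (theta0.neighborSet 0) = 3 := by decide
  rw [Set.ncard_eq_toFinset_card', Set.toFinset_card,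
    ← Fintype.card_congr (f.mapNeighborSet 0), h2] at h
  omega

end Book

end FriendsStrangers

theorem mainTheorem3 :
    (∀ (V : Type*) [Fintype V] (G : SimpleGraph V) (n : ℕ), Fintype.card V = n →
      FriendsStrangers.IsBiconnected G →
      -- the general statement
      (∀ k : ℕ, 2 ≤ k → k ≤ n →
        ¬ (∃ l : ℕ, k + 1 < l ∧ FriendsStrangers.IsCycleOfLength G l) →
        (FriendsStrangers.FS G (FriendsStrangers.bookGraph k (n - k))).Connected) ∧
      -- two empty spaces suffice for every biconnected graph that is not a cycle
      (2 ≤ n → ¬ (∃ l : ℕ, FriendsStrangers.IsCycleOfLength G l) →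
        (FriendsStrangers.FS G (FriendsStrangers.bookGraph 2 (n - 2))).Connected)) ∧
    -- in particular for the exceptional graph of Wilson's theorem
    (FriendsStrangers.FS FriendsStrangers.theta0 (FriendsStrangers.bookGraph 2 5)).Connected := by
  refine ⟨fun V _ G n hn hG => ⟨fun k hk hkn hc =>
    FriendsStrangers.FS_bookGraph_connected hn hG hk hkn hc, fun h2 hc =>
    FriendsStrangers.FS_bookGraph_connected hn hG le_rfl h2 fun ⟨l, _, hl⟩ => hc ⟨l, hl⟩⟩, ?_⟩
  exact FriendsStrangers.FS_bookGraph_connected (n := 7) (by simp)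
    FriendsStrangers.theta0_isBiconnected le_rfl (by norm_num)
    fun ⟨l, _, hl⟩ => FriendsStrangers.theta0_not_cycle l hl
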